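/- For integers $n,i\ge 1$ let $[n]=\{1,\dots,n\}$ and let $\binom{[n]}{i}$ be the family of all $i$-element subsets of $[n]$. Families $\mathscr A,\mathscr B$ of subsets of $[n]$ are *cross-intersecting* if $A\cap B\neq\emptyset$ for all $A\in\mathscr A$, $B\in\mathscr B$. Write $\overline{\mathscr B}=\{[n]\setminus B: B\in\mathscr B\}$. **Theorem.** Let $n,k,l,r$ be integers with $k\ge 1$, $n\ge k+l$, $l\ge r\ge 1$, let $c>0$ be a real number, and let $\mathscr A\subseteq\binom{[n]}{k}$, $\mathscr B\subseteq\binom{[n]}{l}$ be cross-intersecting with $\binom{n-r}{l-r}\le|\mathscr B|\le\binom{n-1}{l-1}$. Put $$M_r=\binom nk-\binom{n-r}{k}+c\binom{n-r}{l-r},\qquad M_1=\binom{n-1}{k-1}+c\binom{n-1}{l-1}.$$ Then $$|\mathscr A|+c|\mathscr B|\le\max\{M_r,M_1\},$$ and equality holds if and only if one of the following holds: (i) $M_r\ge M_1$, $n>k+l$, and for some $R\subseteq[n]$ with $|R|=r$, $\mathscr A=\{A\in\binom{[n]}{k}:R\cap A\ne\emptyset\}$ and $\mathscr B=\{B\in\binom{[n]}{l}:R\subseteq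 B\}$; (ii) $M_r\le M_1$, $n>k+l$, and for some $x\in[n]$, $\mathscr A=\{A\in\binom{[n]}{k}:x\in A\}$ and $\mathscr B=\{B\in\binom{[n]}{l}:x\in B\}$; (iii) $n=k+l$, $c<1$, $|\mathscr B|=\binom{n-r}{l-r}$ and $\mathscr A=\binom{[n]}{k}\setminus\overline{\mathscr B}$; (iv) $n=k+l$, $c=1$, $\binom{n-r}{l-r}\le|\mathscr B|\le\binom{n-1}{l-1}$ and $\mathscr A=\binom{[n]}{k}\setminus\overline{\mathscr B}$; (v) $n=k+l$, $c>1$, $|\mathscr B|=\binom{n-1}{l-1}$ and $\mathscr A=\binom{[n]}{k}\setminus\overline{\mathscr B}$. -/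

import Mathlib

/-- Two families of sets are cross-intersecting if every member of the first
meets every member of the second. -/
def CrossIntersecting {α : Type*} [DecidableEq α] (𝒜 ℬ : Finset (Finset α)) : Prop :=
  ∀ A ∈ 𝒜, ∀ B ∈ ℬ, (A ∩ B).Nonempty

/-- The family of all `k`-subsets of the `n`-element ground set `[n]`, modelled as `Fin n`. -/
def kSets (n k : ℕ) : Finset (Finset (Fin n)) :=
  Finset.powersetCard k Finset.univ

/-- The `k`-sets that meet `R`. -/
def meetFamily {n : ℕ} (k : ℕ) (R : Finset (Fin n)) : Finset (Finset (Fin n)) :=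
  (kSets n k).filter (fun A => (R ∩ A).Nonempty)

/-- The `l`-sets that contain `R`. -/
def containFamily {n : ℕ} (l : ℕ) (R : Finset (Fin n)) : Finset (Finset (Fin n)) :=
  (kSets n l).filter (fun B => R ⊆ B)

/-- The family of the complements (in the ground set) of the members of `ℬ`. -/
def complFamily {n : ℕ} (ℬ : Finset (Finset (Fin n))) : Finset (Finset (Fin n)) :=
  ℬ.image (fun B => Bᶜ)

/-- The value `C(n,k) - C(n-r,k) + c C(n-r,l-r)`, computed in `ℝ`. -/
noncomputable def boundR (n k l r : ℕ) (c : ℝ) : ℝ :=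
  (n.choose k : ℝ) - ((n - r).choose k : ℝ) + c * ((n - r).choose (l - r) : ℝ)

/-- The value `C(n-1,k-1) + c C(n-1,l-1)`, computed in `ℝ`. -/
noncomputable def boundOne (n k l : ℕ) (c : ℝ) : ℝ :=
  ((n - 1).choose (k - 1) : ℝ) + c * ((n - 1).choose (l - 1) : ℝ)

/-!
Let `𝒞` be the family of complements of the members of `ℬ`, a family of sets of size `a = n - l`.
A `k`-set meets every member of `ℬ` exactly when it is contained in no member of `𝒞`, so
`|𝒜| ≤ C(n, k) - |∂ₖ 𝒞|`, where the `k`-shadow `∂ₖ 𝒞` (`Finset.falling k 𝒞`) consists of the `k`-sets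
below members of `𝒞`. If `n = k + l`, the shadow is `𝒞` itself and the sum is at most
`C(n, k) + (c - 1) |ℬ|`, from which everything is read off.

If `n > k + l`, then `k < a`, and the question is how large `c |𝒞| - |∂ₖ 𝒞|` can be when
`C(n - r, a) ≤ |𝒞| ≤ C(n - 1, a)`. The extremal candidates are the families of all `a`-subsets of an
`m`-set, with value `h(m) = c C(m, a) - C(m, k)`. Three facts settle the matter.

* For `C(m, a) ≤ |𝒞| ≤ C(m + 1, a)` the shadow is at least as large as linear interpolation between
  `C(m, k)` and `C(m + 1, k)` predicts, strictly larger in the interior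
  (`exists_card_eq_choose_add`). By Kruskal–Katona it suffices to look at initial segments of colex,
  where this is the local LYM inequality for the link of the last vertex. Hence the value at `𝒞` is
  at most `max (h m) (h (m + 1))`.
* The increments of `h` change sign at most once, from negative to positive, because
  `C(j, k - 1) / C(j, a - 1)` decreases with `j`; so `h` is largest at the ends of the interval
  (`shadowValue_lt_max`). Together with the first fact this shows that an intermediate size of `ℬ`
  is strictly suboptimal (`sub_card_falling_lt_max`).
* A family of `C(m, a)` sets with `C(m, k)` sets in its `k`-shadow consists of all `a`-subsets of an
  `m`-set (`exists_eq_powersetCard_of_card_falling_eq`). The proof compares the degrees of each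
  vertex in the family and in the shadow, in the manner of Keevash's proof of Lovász's theorem. This
  identifies the pairs attaining the bound.
-/

open Finset

/-! ### Families inside a ground set: the local LYM inequality -/

theorem falling_mono {α : Type*} [DecidableEq α] (k : ℕ) {𝒞 𝒟 : Finset (Finset α)} (h : 𝒞 ⊆ 𝒟) :
    falling k 𝒞 ⊆ falling k 𝒟 := by
  intro T hT
  obtain ⟨⟨s, hs, hTs⟩, hc⟩ := mem_falling.1 hT
  exact mem_falling.2 ⟨⟨s, h hs, hTs⟩, hc⟩

theorem falling_eq_shadow_iterate {α : Type*} [DecidableEq α] {𝒞 : Finset (Finset α)} {a k : ℕ}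
    (h : (𝒞 : Set (Finset α)).Sized a) (hk : k ≤ a) :
    falling k 𝒞 = shadow^[a - k] 𝒞 := by
  ext T
  rw [mem_falling, mem_shadow_iterate_iff_exists_mem_card_add]
  constructor
  · rintro ⟨⟨s, hs, hTs⟩, hc⟩
    exact ⟨s, hs, hTs, by rw [h hs]; omega⟩
  · rintro ⟨s, hs, hTs, hc⟩
    rw [h hs] at hc
    exact ⟨⟨s, hs, hTs⟩, by omega⟩

theorem falling_self {α : Type*} [DecidableEq α] {𝒞 : Finset (Finset α)} {a : ℕ}
    (h : (𝒞 : Set (Finset α)).Sized a) : falling a 𝒞 = 𝒞 := by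
  simp [falling_eq_shadow_iterate h le_rfl]

theorem falling_powersetCard {α : Type*} [DecidableEq α] {S : Finset α} {a k : ℕ}
    (hk : k ≤ a) (ha : a ≤ #S) : falling k (powersetCard a S) = powersetCard k S := by
  ext T
  rw [mem_falling, mem_powersetCard]
  constructor
  · rintro ⟨⟨s, hs, hTs⟩, hc⟩
    exact ⟨hTs.trans (mem_powersetCard.1 hs).1, hc⟩
  · rintro ⟨hTS, hc⟩
    obtain ⟨s, hTs, hsS, hs⟩ := exists_subsuperset_card_eq hTS (hc.trans_le hk) ha
    exact ⟨⟨s, mem_powersetCard.2 ⟨hsS, hs⟩, hTs⟩, hc⟩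

theorem falling_subset_powersetCard {α : Type*} [DecidableEq α] {S : Finset α} {a k : ℕ}
    {𝒟 : Finset (Finset α)} (h𝒟 : 𝒟 ⊆ powersetCard a S) : falling k 𝒟 ⊆ powersetCard k S := by
  intro T hT
  obtain ⟨⟨s, hs, hTs⟩, hc⟩ := mem_falling.1 hT
  exact mem_powersetCard.2 ⟨hTs.trans (mem_powersetCard.1 (h𝒟 hs)).1, hc⟩

/-- A nonempty family of `a`-subsets of `S` that is closed under exchanging one element for another
is the family of all `a`-subsets of `S`. -/
theorem eq_powersetCard_of_exchange {α : Type*} [DecidableEq α] {S : Finset α} {a : ℕ}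
    {𝒟 : Finset (Finset α)} (h𝒟 : 𝒟 ⊆ powersetCard a S) (hne : 𝒟.Nonempty)
    (hex : ∀ D ∈ 𝒟, ∀ x ∈ D, ∀ y ∈ S \ D, insert y (D.erase x) ∈ 𝒟) :
    𝒟 = powersetCard a S := by
  refine h𝒟.antisymm fun E hE => ?_
  obtain ⟨hES, hEc⟩ := mem_powersetCard.1 hE
  -- a member with the fewest elements outside `E` is `E` itself
  obtain ⟨D, hD, hmin⟩ := exists_min_image 𝒟 (fun D => #(D \ E)) hne
  obtain ⟨hDS, hDc⟩ := mem_powersetCard.1 (h𝒟 hD)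
  by_cases hDE : D ⊆ E
  · rwa [← eq_of_subset_of_card_le hDE (by omega)]
  · exfalso
    obtain ⟨x, hx⟩ := sdiff_nonempty.2 hDE
    have hED : ¬ E ⊆ D := fun h => hDE (eq_of_subset_of_card_le h (by omega)).ge
    obtain ⟨y, hy⟩ := sdiff_nonempty.2 hED
    rw [mem_sdiff] at hx hy
    have h1 := hmin _ (hex D hD x hx.1 y (mem_sdiff.2 ⟨hES hy.1, hy.2⟩))
    have h2 : insert y (D.erase x) \ E = (D \ E).erase x := by
      ext z
      simp only [mem_sdiff, mem_insert, mem_erase]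
      constructor
      · rintro ⟨rfl | h, hz⟩
        · exact absurd hy.1 hz
        · exact ⟨h.1, h.2, hz⟩
      · rintro ⟨h, h', h''⟩
        exact ⟨Or.inr ⟨h, h'⟩, h''⟩
    rw [h2] at h1
    exact absurd (card_erase_lt_of_mem (mem_sdiff.2 hx)) (not_lt.2 h1)

theorem card_supersets_le {α : Type*} [DecidableEq α] {S T : Finset α} {a k : ℕ}
    {𝒟 : Finset (Finset α)} (h𝒟 : 𝒟 ⊆ powersetCard a S) (hk : k ≤ a) (hT : T ∈ falling k 𝒟) :
    #(𝒟.filter (T ⊆ ·)) ≤ (#S - k).choose (a - k) := by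
  obtain ⟨hTS, hTc⟩ := mem_powersetCard.1 (falling_subset_powersetCard h𝒟 hT)
  have h := card_filter_powersetCard_subset T S a hTS (hTc.trans_le hk)
  rw [hTc] at h
  exact h ▸ card_le_card (filter_subset_filter _ h𝒟)

theorem sum_card_supersets {α : Type*} [DecidableEq α] {a k : ℕ}
    {𝒟 : Finset (Finset α)} (h𝒟 : (𝒟 : Set (Finset α)).Sized a) :
    ∑ T ∈ falling k 𝒟, #(𝒟.filter (T ⊆ ·)) = #𝒟 * a.choose k := by
  have h := sum_card_bipartiteAbove_eq_sum_card_bipartiteBelow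
    (s := 𝒟) (t := falling k 𝒟) (fun D T => T ⊆ D)
  simp only [bipartiteBelow] at h
  rw [← h, ← smul_eq_mul, ← sum_const]
  refine sum_congr rfl fun D hD => ?_
  rw [← h𝒟 hD, ← card_powersetCard]
  congr 1
  ext T
  simp only [bipartiteAbove, mem_filter, mem_falling, mem_powersetCard]
  exact ⟨fun h => ⟨h.2, h.1.2⟩, fun h => ⟨⟨⟨D, hD, h.1⟩, h.2⟩, h.1⟩⟩

/-- Local LYM inequality between the levels `a` and `k` of the subsets of `S`. -/
theorem card_mul_choose_le_card_falling_mul_choose {α : Type*} [DecidableEq α] {S : Finset α}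
    {a k : ℕ} {𝒟 : Finset (Finset α)} (h𝒟 : 𝒟 ⊆ powersetCard a S) (hk : k ≤ a) (ha : a ≤ #S) :
    #𝒟 * (#S).choose k ≤ #(falling k 𝒟) * (#S).choose a := by
  have hs : (𝒟 : Set (Finset α)).Sized a := fun s hs => (mem_powersetCard.1 (h𝒟 hs)).2
  have h := sum_le_card_nsmul _ _ _ fun T hT => card_supersets_le h𝒟 hk hT
  rw [sum_card_supersets hs, smul_eq_mul] at h
  have hpos : 0 < (#S - k).choose (a - k) := Nat.choose_pos (by omega)
  refine Nat.le_of_mul_le_mul_right ?_ hpos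
  calc #𝒟 * (#S).choose k * (#S - k).choose (a - k)
      = (#𝒟 * a.choose k) * (#S).choose a := by
        rw [mul_assoc, ← Nat.choose_mul hk]; ring
    _ ≤ (#(falling k 𝒟) * (#S - k).choose (a - k)) * (#S).choose a := by gcongr
    _ = _ := by ring

/-- The local LYM inequality is strict unless the family is empty or consists of all `a`-sets. If it
is an equality, then every `a`-set above a member of the `k`-shadow belongs to the family, which is
therefore closed under exchange. -/
theorem card_mul_choose_lt_card_falling_mul_choose {α : Type*} [DecidableEq α] {S : Finset α}
    {a k : ℕ} {𝒟 : Finset (Finset α)} (h𝒟 : 𝒟 ⊆ powersetCard a S) (hk : k < a) (ha : a ≤ #S)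
    (hpos : 0 < #𝒟) (hlt : #𝒟 < (#S).choose a) :
    #𝒟 * (#S).choose k < #(falling k 𝒟) * (#S).choose a := by
  have hs : (𝒟 : Set (Finset α)).Sized a := fun s hs => (mem_powersetCard.1 (h𝒟 hs)).2
  have hT : ∃ T ∈ falling k 𝒟, #(𝒟.filter (T ⊆ ·)) < (#S - k).choose (a - k) := by
    by_contra! hcon
    have hmem : ∀ T ∈ falling k 𝒟, ∀ E ∈ powersetCard a S, T ⊆ E → E ∈ 𝒟 := by
      intro T hT E hE hTE
      obtain ⟨hTS, hTc⟩ := mem_powersetCard.1 (falling_subset_powersetCard h𝒟 hT)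
      have h := card_filter_powersetCard_subset T S a hTS (hTc.trans_le hk.le)
      rw [hTc] at h
      have heq := eq_of_subset_of_card_le (filter_subset_filter (T ⊆ ·) h𝒟)
        (h.trans_le (hcon T hT))
      have : E ∈ 𝒟.filter (T ⊆ ·) := by rw [heq]; exact mem_filter.2 ⟨hE, hTE⟩
      exact (mem_filter.1 this).1
    have := eq_powersetCard_of_exchange h𝒟 (card_pos.1 hpos) fun D hD x hx y hy => by
      have hDc := hs hD
      obtain ⟨T, hTD, hTc⟩ := exists_subset_card_eq (s := D.erase x) (n := k)
        (by rw [card_erase_of_mem hx]; omega)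
      rw [mem_sdiff] at hy
      refine hmem T (mem_falling.2 ⟨⟨D, hD, hTD.trans (erase_subset _ _)⟩, hTc⟩) _
        (mem_powersetCard.2 ⟨?_, ?_⟩) (hTD.trans (subset_insert _ _))
      · exact insert_subset hy.1 ((erase_subset _ _).trans (mem_powersetCard.1 (h𝒟 hD)).1)
      · rw [card_insert_of_notMem fun h => hy.2 (mem_of_mem_erase h), card_erase_add_one hx, hDc]
    rw [this, card_powersetCard] at hlt
    exact hlt.false
  have h := sum_lt_sum (fun T hT => card_supersets_le h𝒟 hk.le hT) hT
  rw [sum_card_supersets hs, sum_const, smul_eq_mul] at h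
  have hpos' : 0 < (#S).choose a := Nat.choose_pos ha
  refine Nat.lt_of_mul_lt_mul_right (a := (#S - k).choose (a - k)) ?_
  calc #𝒟 * (#S).choose k * (#S - k).choose (a - k)
      = (#𝒟 * a.choose k) * (#S).choose a := by
        rw [mul_assoc, ← Nat.choose_mul hk.le]; ring
    _ < (#(falling k 𝒟) * (#S - k).choose (a - k)) * (#S).choose a := by gcongr
    _ = _ := by ring

/-! ### Links of a vertex -/

theorem memberSubfamily_falling {α : Type*} [DecidableEq α] (v : α) (k : ℕ)
    (𝒞 : Finset (Finset α)) :
    (falling (k + 1) 𝒞).memberSubfamily v = falling k (𝒞.memberSubfamily v) := by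
  ext T
  simp only [mem_memberSubfamily, mem_falling]
  constructor
  · rintro ⟨⟨⟨s, hs, hTs⟩, hc⟩, hv⟩
    have hvs : v ∈ s := hTs (mem_insert_self _ _)
    refine ⟨⟨s.erase v, ⟨by rwa [insert_erase hvs], notMem_erase _ _⟩, ?_⟩, ?_⟩
    · exact subset_erase.2 ⟨(subset_insert _ _).trans hTs, hv⟩
    · rw [card_insert_of_notMem hv] at hc; omega
  · rintro ⟨⟨s, ⟨hs, hv⟩, hTs⟩, hc⟩
    have hvT : v ∉ T := fun h => hv (hTs h)
    exact ⟨⟨⟨_, hs, insert_subset_insert _ hTs⟩, by rw [card_insert_of_notMem hvT, hc]⟩, hvT⟩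

theorem falling_memberSubfamily_subset {α : Type*} [DecidableEq α] (v : α) (k : ℕ)
    (𝒞 : Finset (Finset α)) :
    falling k (𝒞.memberSubfamily v) ⊆ (falling k 𝒞).nonMemberSubfamily v := by
  intro T hT
  obtain ⟨⟨s, hs, hTs⟩, hc⟩ := mem_falling.1 hT
  obtain ⟨hs, hv⟩ := mem_memberSubfamily.1 hs
  exact mem_nonMemberSubfamily.2
    ⟨mem_falling.2 ⟨⟨_, hs, hTs.trans (subset_insert _ _)⟩, hc⟩, fun h => hv (hTs h)⟩

theorem sized_memberSubfamily {α : Type*} [DecidableEq α] (v : α) {a : ℕ}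
    {𝒞 : Finset (Finset α)} (h : (𝒞 : Set (Finset α)).Sized (a + 1)) :
    (𝒞.memberSubfamily v : Set (Finset α)).Sized a := by
  intro s hs
  obtain ⟨hs, hv⟩ := mem_memberSubfamily.1 (mem_coe.1 hs)
  have := h hs
  rw [card_insert_of_notMem hv] at this
  omega

theorem card_memberSubfamily {α : Type*} [DecidableEq α] (v : α) (𝒞 : Finset (Finset α)) :
    #(𝒞.memberSubfamily v) = #(𝒞.filter (v ∈ ·)) :=
  card_image_of_injOn ((erase_injOn' v).mono fun s hs => by simpa using (mem_filter.1 hs).2)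

theorem sum_card_memberSubfamily {α : Type*} [DecidableEq α] [Fintype α] {a : ℕ}
    {𝒞 : Finset (Finset α)} (h : (𝒞 : Set (Finset α)).Sized a) :
    ∑ v, #(𝒞.memberSubfamily v) = #𝒞 * a := by
  have h' := sum_card_bipartiteAbove_eq_sum_card_bipartiteBelow
    (s := (univ : Finset α)) (t := 𝒞) (fun v s => v ∈ s)
  simp only [bipartiteAbove, bipartiteBelow, filter_univ_mem] at h'
  simp only [card_memberSubfamily]
  rw [h', sum_congr rfl fun s hs => h hs, sum_const, smul_eq_mul]

/-! ### Initial segments of colex and the Kruskal–Katona theorem -/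

/-- The first `m` elements of the ground set `Fin n`. -/
def firstElements (n m : ℕ) : Finset (Fin n) := {x | (x : ℕ) < m}

theorem mem_firstElements {n m : ℕ} {x : Fin n} : x ∈ firstElements n m ↔ (x : ℕ) < m := by
  simp [firstElements]

theorem card_firstElements {n m : ℕ} (h : m ≤ n) : #(firstElements n m) = m := by
  simp [firstElements, Fin.card_filter_val_lt, h]

theorem isInitSeg_powersetCard_firstElements (n m a : ℕ) :
    Colex.IsInitSeg (powersetCard a (firstElements n m)) a := by
  refine ⟨Set.sized_powersetCard _ _, fun s t hs ht => ?_⟩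
  refine mem_powersetCard.2 ⟨fun x hx => ?_, ht.2⟩
  have hs' := (mem_powersetCard.1 hs).1
  rw [mem_firstElements]
  have h : toColex (image Fin.val t) < toColex (image Fin.val s) := by
    rw [Colex.toColex_image_lt_toColex_image Fin.val_strictMono]
    exact ht.1
  refine Colex.forall_lt_mono h.le ?_ _ (mem_image_of_mem _ hx)
  simp only [mem_image]
  rintro _ ⟨y, hy, rfl⟩
  exact mem_firstElements.1 (hs' hy)

theorem exists_isInitSeg_card {n a : ℕ} : ∀ q ≤ n.choose a,
    ∃ I : Finset (Finset (Fin n)), Colex.IsInitSeg I a ∧ #I = q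
  | 0, _ => ⟨∅, Colex.isInitSeg_empty, rfl⟩
  | q + 1, hq => by
    obtain ⟨I, hI, hIc⟩ := exists_isInitSeg_card (n := n) (a := a) q (by omega)
    have hne : (powersetCard a (univ : Finset (Fin n)) \ I).Nonempty := by
      rw [← card_pos]
      have := le_card_sdiff I (powersetCard a (univ : Finset (Fin n)))
      rw [card_powersetCard, card_univ, Fintype.card_fin] at this
      omega
    obtain ⟨s, hs, hmin⟩ := exists_min_image _ (fun s => toColex s) hne
    rw [mem_sdiff, mem_powersetCard] at hs
    refine ⟨insert s I, ⟨?_, ?_⟩, by rw [card_insert_of_notMem hs.2, hIc]⟩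
    · intro t ht
      rcases mem_insert.1 (mem_coe.1 ht) with rfl | ht
      exacts [hs.1.2, hI.1 ht]
    · rintro t u ht ⟨hut, huc⟩
      rcases mem_insert.1 ht with rfl | ht
      · by_contra hu
        refine absurd (hmin u (mem_sdiff.2 ⟨mem_powersetCard.2 ⟨subset_univ _, huc⟩,
          fun h => hu (mem_insert_of_mem h)⟩)) (not_le.2 hut)
      · exact mem_insert_of_mem (hI.2 ht ⟨hut, huc⟩)

/-- Kruskal–Katona: every uniform family is dominated, as regards its `k`-shadow, by an initial
segment of colex of the same size. -/
theorem exists_isInitSeg_card_falling_le {n a k : ℕ} {𝒞 : Finset (Finset (Fin n))}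
    (h𝒞 : (𝒞 : Set (Finset (Fin n))).Sized a) (hk : k ≤ a) :
    ∃ I : Finset (Finset (Fin n)), Colex.IsInitSeg I a ∧ #I = #𝒞 ∧
      #(falling k I) ≤ #(falling k 𝒞) := by
  obtain ⟨I, hI, hIc⟩ := exists_isInitSeg_card (n := n) (a := a) (#𝒞)
    (by simpa using h𝒞.card_le)
  refine ⟨I, hI, hIc, ?_⟩
  rw [falling_eq_shadow_iterate hI.1 hk, falling_eq_shadow_iterate h𝒞 hk]
  exact iterated_kk h𝒞 hIc.le hI

theorem subset_powersetCard_firstElements {n a m : ℕ} {I : Finset (Finset (Fin n))}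
    (hI : Colex.IsInitSeg I a) (hm : m ≤ n) (hc : #I ≤ m.choose a) :
    I ⊆ powersetCard a (firstElements n m) := by
  rcases hI.total (isInitSeg_powersetCard_firstElements n m a) with h | h
  · exact h
  · rw [eq_of_subset_of_card_le h (by rwa [card_powersetCard, card_firstElements hm])]

theorem powersetCard_firstElements_subset {n a m : ℕ} {I : Finset (Finset (Fin n))}
    (hI : Colex.IsInitSeg I a) (hm : m ≤ n) (hc : m.choose a ≤ #I) :
    powersetCard a (firstElements n m) ⊆ I := by
  rcases hI.total (isInitSeg_powersetCard_firstElements n m a) with h | h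
  · rw [eq_of_subset_of_card_le h (by rwa [card_powersetCard, card_firstElements hm])]
  · exact h

/-- A family of at most `m.choose a` sets satisfies the local LYM inequality as if its ground set
had only `m` elements. -/
theorem card_mul_choose_le_card_falling_of_card_le {n a k m : ℕ} {𝒟 : Finset (Finset (Fin n))}
    (h𝒟 : (𝒟 : Set (Finset (Fin n))).Sized a) (hk : k ≤ a) (ha : a ≤ m) (hm : m ≤ n)
    (hc : #𝒟 ≤ m.choose a) :
    #𝒟 * m.choose k ≤ #(falling k 𝒟) * m.choose a := by
  obtain ⟨I, hI, hIc, hle⟩ := exists_isInitSeg_card_falling_le h𝒟 hk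
  have h := card_mul_choose_le_card_falling_mul_choose
    (subset_powersetCard_firstElements hI hm (hIc.trans_le hc)) hk
    (by rwa [card_firstElements hm])
  rw [card_firstElements hm, hIc] at h
  exact h.trans (by gcongr)

theorem card_mul_choose_lt_card_falling_of_card_lt {n a k m : ℕ} {𝒟 : Finset (Finset (Fin n))}
    (h𝒟 : (𝒟 : Set (Finset (Fin n))).Sized a) (hk : k < a) (ha : a ≤ m) (hm : m ≤ n)
    (hpos : 0 < #𝒟) (hc : #𝒟 < m.choose a) :
    #𝒟 * m.choose k < #(falling k 𝒟) * m.choose a := by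
  obtain ⟨I, hI, hIc, hle⟩ := exists_isInitSeg_card_falling_le h𝒟 hk.le
  have h := card_mul_choose_lt_card_falling_mul_choose
    (subset_powersetCard_firstElements hI hm (hIc.trans_le hc.le)) hk
    (by rwa [card_firstElements hm]) (by rwa [hIc]) (by rwa [card_firstElements hm, hIc])
  rw [card_firstElements hm, hIc] at h
  exact h.trans_le (by gcongr)

/-- Lovász's form of the Kruskal–Katona theorem. -/
theorem choose_le_card_falling {n a k m : ℕ} {𝒞 : Finset (Finset (Fin n))}
    (h𝒞 : (𝒞 : Set (Finset (Fin n))).Sized a) (hk : k ≤ a) (ha : a ≤ m) (hm : m ≤ n)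
    (hc : m.choose a ≤ #𝒞) : m.choose k ≤ #(falling k 𝒞) := by
  obtain ⟨I, hI, hIc, hle⟩ := exists_isInitSeg_card_falling_le h𝒞 hk
  have h := card_le_card (falling_mono k (powersetCard_firstElements_subset hI hm (hIc ▸ hc)))
  rw [falling_powersetCard hk (by rwa [card_firstElements hm]), card_powersetCard,
    card_firstElements hm] at h
  exact h.trans hle

/-- For a family of `(a + 1)`-sets whose size lies between `m.choose (a + 1)` and
`(m + 1).choose (a + 1)`, the size of the `(k + 1)`-shadow is at least the linear interpolation
between `m.choose (k + 1)` and `(m + 1).choose (k + 1)`, and larger if the size is strictly between. In a colex-initial family, the sets that contain the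
last vertex contribute `d` sets to the family and `t` to the shadow, and the local LYM inequality
for the link of that vertex bounds `t` from below. -/
theorem exists_card_eq_choose_add {n a k m : ℕ} {𝒞 : Finset (Finset (Fin n))}
    (h𝒞 : (𝒞 : Set (Finset (Fin n))).Sized (a + 1)) (hk : k < a) (ha : a + 1 ≤ m) (hm : m < n)
    (hlo : m.choose (a + 1) ≤ #𝒞) (hhi : #𝒞 ≤ (m + 1).choose (a + 1)) :
    ∃ d t, #𝒞 = m.choose (a + 1) + d ∧ m.choose (k + 1) + t ≤ #(falling (k + 1) 𝒞) ∧
      d ≤ m.choose a ∧ d * m.choose k ≤ t * m.choose a ∧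
      (0 < d → d < m.choose a → d * m.choose k < t * m.choose a) := by
  obtain ⟨I, hI, hIc, hle⟩ := exists_isInitSeg_card_falling_le h𝒞 (k := k + 1) (by omega)
  have hsub := subset_powersetCard_firstElements hI hm (hIc.trans_le hhi)
  have hsup := powersetCard_firstElements_subset hI hm.le (hIc ▸ hlo)
  set v : Fin n := ⟨m, hm⟩
  have hcardm := card_firstElements (n := n) hm.le
  have hnon : I.nonMemberSubfamily v = powersetCard (a + 1) (firstElements n m) := by
    ext s
    rw [mem_nonMemberSubfamily]
    constructor
    · rintro ⟨hs, hv⟩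
      obtain ⟨hsS, hc⟩ := mem_powersetCard.1 (hsub hs)
      refine mem_powersetCard.2 ⟨fun x hx => ?_, hc⟩
      have h1 := mem_firstElements.1 (hsS hx)
      have h2 : (x : ℕ) ≠ m := fun h => hv ((Fin.ext h : x = v) ▸ hx)
      exact mem_firstElements.2 (by omega)
    · intro hs
      refine ⟨hsup hs, fun hv => ?_⟩
      exact absurd (mem_firstElements.1 ((mem_powersetCard.1 hs).1 hv)) (lt_irrefl m)
  have hlink : I.memberSubfamily v ⊆ powersetCard a (firstElements n m) := by
    intro s hs
    obtain ⟨hs', hv⟩ := mem_memberSubfamily.1 hs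
    refine mem_powersetCard.2 ⟨fun x hx => ?_, sized_memberSubfamily v hI.1 hs⟩
    have h1 := mem_firstElements.1 ((mem_powersetCard.1 (hsub hs')).1 (mem_insert_of_mem hx))
    have h2 : (x : ℕ) ≠ m := fun h => hv ((Fin.ext h : x = v) ▸ hx)
    exact mem_firstElements.2 (by omega)
  have hsplit := card_memberSubfamily_add_card_nonMemberSubfamily v I
  have hsplit' := card_memberSubfamily_add_card_nonMemberSubfamily v (falling (k + 1) I)
  rw [memberSubfamily_falling] at hsplit'
  have hnon' : m.choose (k + 1) ≤ #((falling (k + 1) I).nonMemberSubfamily v) := by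
    have h : powersetCard (k + 1) (firstElements n m) ⊆
        (falling (k + 1) I).nonMemberSubfamily v := by
      intro T hT
      refine mem_nonMemberSubfamily.2 ⟨?_, fun hv => ?_⟩
      · rw [← falling_powersetCard (a := a + 1) (by omega) (by rwa [hcardm])] at hT
        exact falling_mono _ hsup hT
      · exact absurd (mem_firstElements.1 ((mem_powersetCard.1 hT).1 hv)) (lt_irrefl m)
    have := card_le_card h
    rwa [card_powersetCard, hcardm] at this
  rw [hnon, card_powersetCard, hcardm] at hsplit
  refine ⟨#(I.memberSubfamily v), #(falling k (I.memberSubfamily v)), by omega, by omega, ?_, ?_,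
    fun h0 h1 => ?_⟩
  · have := card_le_card hlink
    rwa [card_powersetCard, hcardm] at this
  · have := card_mul_choose_le_card_falling_mul_choose hlink hk.le (by rw [hcardm]; omega)
    rwa [hcardm] at this
  · have := card_mul_choose_lt_card_falling_mul_choose hlink hk (by rw [hcardm]; omega) h0
      (by rwa [hcardm])
    rwa [hcardm] at this

/-- A strict version of `choose_le_card_falling`; the levels are shifted by one because it fails
for the shadow on level `0`, which never has more than one member. -/
theorem choose_lt_card_falling {n a k m : ℕ} {𝒞 : Finset (Finset (Fin n))}
    (h𝒞 : (𝒞 : Set (Finset (Fin n))).Sized (a + 1)) (hk : k ≤ a) (ha : a + 1 ≤ m) (hm : m ≤ n)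
    (hc : m.choose (a + 1) < #𝒞) : m.choose (k + 1) < #(falling (k + 1) 𝒞) := by
  rcases hk.eq_or_lt with rfl | hk
  · rwa [falling_self h𝒞]
  have hmn : m < n := by
    refine hm.lt_of_ne ?_
    rintro rfl
    have := h𝒞.card_le
    rw [Fintype.card_fin] at this
    omega
  obtain ⟨𝒟, h𝒟, h𝒟c⟩ := exists_subset_card_eq (s := 𝒞) (n := m.choose (a + 1) + 1) hc
  have hpos : 0 < m.choose a := Nat.choose_pos (by omega)
  obtain ⟨d, t, hd, ht, -, hdt, -⟩ := exists_card_eq_choose_add (h𝒞.mono (coe_subset.2 h𝒟)) hk ha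
    hmn (by omega) (by rw [h𝒟c, Nat.choose_succ_succ']; omega)
  have hd1 : d = 1 := by omega
  have hkpos : 0 < m.choose k := Nat.choose_pos (by omega)
  have htpos : 0 < t := by
    rw [hd1, one_mul] at hdt
    exact Nat.pos_of_ne_zero fun h => by simp [h] at hdt; omega
  have := card_le_card (falling_mono (k + 1) h𝒟)
  omega

/-- Uniqueness in Lovász's form of the Kruskal–Katona theorem: a family of `m.choose a` sets of size
`a` with exactly `m.choose k` sets in its `k`-shadow, `1 ≤ k < a`, consists of all `a`-subsets of
some `m`-set. Links of vertices have at most `(m - 1).choose (a - 1)` members, since otherwise the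
shadow would be too large; so the local LYM inequality bounds the degree of each vertex in the
family by a fixed multiple of its degree in the shadow. Summed over all vertices this is an
equality, hence every vertex of positive degree has degree `(m - 1).choose (a - 1)`, and there are
exactly `m` of them. -/
theorem exists_eq_powersetCard_of_card_falling_eq {n a k m : ℕ} {𝒞 : Finset (Finset (Fin n))}
    (h𝒞 : (𝒞 : Set (Finset (Fin n))).Sized a) (hk1 : 1 ≤ k) (hk : k < a) (ha : a ≤ m)
    (hm : m ≤ n) (hc : #𝒞 = m.choose a) (hf : #(falling k 𝒞) = m.choose k) :
    ∃ S : Finset (Fin n), #S = m ∧ 𝒞 = powersetCard a S := by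
  obtain ⟨k, rfl⟩ : ∃ k', k = k' + 1 := ⟨k - 1, by omega⟩
  obtain ⟨a, rfl⟩ : ∃ a', a = a' + 1 := ⟨a - 1, by omega⟩
  obtain ⟨m, rfl⟩ : ∃ m', m = m' + 1 := ⟨m - 1, by omega⟩
  have hpa : 0 < m.choose a := Nat.choose_pos (by omega)
  have hlink : ∀ v, #(𝒞.memberSubfamily v) ≤ m.choose a := by
    intro v
    by_contra! hv
    obtain ⟨b, rfl⟩ : ∃ b, a = b + 1 := ⟨a - 1, by omega⟩
    have hs := sized_memberSubfamily v h𝒞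
    have h1 := choose_le_card_falling (k := k) hs (by omega) (by omega) (by omega) hv.le
    have h2 := choose_lt_card_falling (k := k) hs (by omega) (by omega) (by omega) hv
    have h3 := card_le_card (falling_memberSubfamily_subset v (k + 1) 𝒞)
    have h4 := card_memberSubfamily_add_card_nonMemberSubfamily v (falling (k + 1) 𝒞)
    rw [memberSubfamily_falling, hf, Nat.choose_succ_succ'] at h4
    omega
  have hle : ∀ v ∈ univ, #(𝒞.memberSubfamily v) * m.choose k ≤
      #((falling (k + 1) 𝒞).memberSubfamily v) * m.choose a := by
    intro v _
    rw [memberSubfamily_falling]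
    exact card_mul_choose_le_card_falling_of_card_le (sized_memberSubfamily v h𝒞) (by omega)
      (by omega) (by omega) (hlink v)
  have hsum : ∑ v, #(𝒞.memberSubfamily v) * m.choose k =
      ∑ v, #((falling (k + 1) 𝒞).memberSubfamily v) * m.choose a := by
    rw [← sum_mul, ← sum_mul, sum_card_memberSubfamily h𝒞,
      sum_card_memberSubfamily (sized_falling (k + 1) 𝒞), hc, hf, ← Nat.add_one_mul_choose_eq,
      ← Nat.add_one_mul_choose_eq]
    ring
  have heq := (sum_eq_sum_iff_of_le hle).1 hsum
  have hdeg : ∀ v, #(𝒞.memberSubfamily v) = 0 ∨ #(𝒞.memberSubfamily v) = m.choose a := by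
    intro v
    by_contra! h
    have h1 := card_mul_choose_lt_card_falling_of_card_lt (k := k) (sized_memberSubfamily v h𝒞)
      (by omega) (by omega) (by omega) (Nat.pos_of_ne_zero h.1) (lt_of_le_of_ne (hlink v) h.2)
    rw [← memberSubfamily_falling, ← heq v (mem_univ v)] at h1
    exact h1.false
  set S : Finset (Fin n) := {v | #(𝒞.memberSubfamily v) = m.choose a} with hS
  have hScard : #S = m + 1 := by
    have h1 : ∑ v, #(𝒞.memberSubfamily v) = #S * m.choose a := by
      rw [← smul_eq_mul, ← sum_const, hS, sum_filter]
      refine sum_congr rfl fun v _ => ?_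
      split_ifs with h
      · exact h
      · exact (hdeg v).resolve_right h
    rw [sum_card_memberSubfamily h𝒞, hc, ← Nat.add_one_mul_choose_eq] at h1
    exact (Nat.eq_of_mul_eq_mul_right hpa h1).symm
  refine ⟨S, hScard, eq_of_subset_of_card_le (fun s hs => ?_) ?_⟩
  · refine mem_powersetCard.2 ⟨fun v hv => ?_, h𝒞 hs⟩
    rw [hS, mem_filter]
    refine ⟨mem_univ _, (hdeg v).resolve_left ?_⟩
    rw [card_memberSubfamily]
    exact (card_pos.2 ⟨s, mem_filter.2 ⟨hs, hv⟩⟩).ne'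
  · rw [card_powersetCard, hScard, hc]

/-! ### Convexity of the bounds in the size parameter -/

/-- A sequence whose increments can only go from nonnegative to positive takes its maximum over an
interval at the ends, and at no interior point. -/
theorem lt_max_of_increments {h : ℕ → ℝ} {p q : ℕ}
    (hinc : ∀ j, p ≤ j → 0 ≤ h (j + 1) - h j → 0 < h (j + 2) - h (j + 1)) {m : ℕ}
    (hpm : p < m) (hmq : m < q) : h m < max (h p) (h q) := by
  obtain ⟨m, rfl⟩ : ∃ m', m = m' + 1 := ⟨m - 1, by omega⟩
  rcases le_or_gt 0 (h (m + 1) - h m) with h0 | h0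
  · refine lt_max_of_lt_right ?_
    have hpos : ∀ j, m + 1 ≤ j → 0 < h (j + 1) - h j := fun j hj =>
      Nat.le_induction (hinc m (by omega) h0)
        (fun j hj hj' => hinc j (by omega) hj'.le) j hj
    have : ∀ j, m + 2 ≤ j → h (m + 1) < h j := fun j hj =>
      Nat.le_induction (by linarith [hpos (m + 1) le_rfl])
        (fun j hj hj' => by linarith [hpos j (by omega)]) j hj
    exact this q (by omega)
  · refine lt_max_of_lt_left ?_
    have hneg : ∀ i, p + i ≤ m → h (m + 1) < h (m - i) := by
      intro i
      induction i with
      | zero => intro _; simpa using h0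
      | succ i ih =>
        intro hi
        have ih := ih (by omega)
        by_contra! hcon
        obtain ⟨j, hj⟩ : ∃ j, m - (i + 1) = j := ⟨_, rfl⟩
        have hj1 : m - i = j + 1 := by omega
        rw [hj] at hcon
        rw [hj1] at ih
        have hup : ∀ j', j ≤ j' → 0 ≤ h (j' + 1) - h j' := fun j' hj' =>
          Nat.le_induction (by linarith)
            (fun j' hj' h' => (hinc j' (by omega) h').le) j' hj'
        linarith [hup m (by omega)]
    have := hneg (m - p) (by omega)
    rwa [show m - (m - p) = p by omega] at this

/-- The ratio of `j.choose k` to `j.choose a` is strictly decreasing in `j`, for `k < a`. -/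
theorem choose_succ_mul_choose_lt {j a k : ℕ} (hk : k < a) (ha : a ≤ j) :
    (j + 1).choose k * j.choose a < j.choose k * (j + 1).choose a := by
  have h1 := Nat.choose_mul_succ_eq j k
  have h2 := Nat.choose_mul_succ_eq j a
  have p1 : 0 < j.choose k := Nat.choose_pos (by omega)
  have p2 : 0 < (j + 1).choose a := Nat.choose_pos (by omega)
  refine Nat.lt_of_mul_lt_mul_right (a := j + 1) ?_
  calc (j + 1).choose k * j.choose a * (j + 1)
      = (j + 1).choose k * (j + 1).choose a * (j + 1 - a) := by rw [mul_assoc, h2, mul_assoc]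
    _ < (j + 1).choose k * (j + 1).choose a * (j + 1 - k) :=
        Nat.mul_lt_mul_of_pos_left (by omega)
          (Nat.mul_pos (Nat.choose_pos (by omega)) p2)
    _ = (j + 1).choose a * ((j + 1).choose k * (j + 1 - k)) := by ring
    _ = j.choose k * (j + 1).choose a * (j + 1) := by rw [← h1]; ring

theorem choose_increment_pos {j a k : ℕ} {c : ℝ} (hk : k < a) (ha : a ≤ j)
    (h : 0 ≤ c * j.choose a - j.choose k) :
    0 < c * (j + 1).choose a - (j + 1).choose k := by
  have h1 : ((j + 1).choose k : ℝ) * j.choose a < j.choose k * (j + 1).choose a := by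
    exact_mod_cast choose_succ_mul_choose_lt hk ha
  have p1 : (0 : ℝ) < j.choose a := by exact_mod_cast Nat.choose_pos ha
  have p2 : (0 : ℝ) < (j + 1).choose a := by exact_mod_cast Nat.choose_pos (by omega)
  nlinarith

/-- The value of `c` times the size minus the size of the `k`-shadow, for the family of all
`a`-subsets of a `j`-set. -/
noncomputable def shadowValue (a k : ℕ) (c : ℝ) (j : ℕ) : ℝ := c * j.choose a - j.choose k

theorem shadowValue_succ_sub (a k : ℕ) (c : ℝ) (j : ℕ) :
    shadowValue (a + 1) (k + 1) c (j + 1) - shadowValue (a + 1) (k + 1) c j =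
      c * j.choose a - j.choose k := by
  simp only [shadowValue, Nat.choose_succ_succ']
  push_cast
  ring

theorem shadowValue_lt_max {a k p q m : ℕ} (c : ℝ) (hk1 : 1 ≤ k) (hk : k < a) (ha : a ≤ p)
    (hpm : p < m) (hmq : m < q) :
    shadowValue a k c m < max (shadowValue a k c p) (shadowValue a k c q) := by
  obtain ⟨k, rfl⟩ : ∃ k', k = k' + 1 := ⟨k - 1, by omega⟩
  obtain ⟨a, rfl⟩ : ∃ a', a = a' + 1 := ⟨a - 1, by omega⟩
  refine lt_max_of_increments (fun j hj h => ?_) hpm hmq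
  rw [shadowValue_succ_sub] at h
  rw [show j + 2 = j + 1 + 1 from rfl, shadowValue_succ_sub]
  exact choose_increment_pos (by omega) (by omega) h

/-- A family whose size is strictly between `p.choose a` and `q.choose a` has a smaller value of `c`
times the size minus the size of the `k`-shadow than the better of the two families of all
`a`-subsets of a `p`-set and of a `q`-set. -/
theorem sub_card_falling_lt_max {n a k p q : ℕ} (c : ℝ) {𝒞 : Finset (Finset (Fin n))}
    (h𝒞 : (𝒞 : Set (Finset (Fin n))).Sized a) (hk1 : 1 ≤ k) (hk : k < a) (ha : a ≤ p)
    (hpq : p ≤ q) (hq : q ≤ n) (hlo : p.choose a < #𝒞) (hhi : #𝒞 < q.choose a) :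
    c * #𝒞 - #(falling k 𝒞) < max (shadowValue a k c p) (shadowValue a k c q) := by
  have hmax : ∀ m, p ≤ m → m ≤ q →
      shadowValue a k c m ≤ max (shadowValue a k c p) (shadowValue a k c q) := by
    intro m hpm hmq
    rcases hpm.eq_or_lt with rfl | hpm
    · exact le_max_left _ _
    rcases hmq.eq_or_lt with rfl | hmq
    · exact le_max_right _ _
    exact (shadowValue_lt_max c hk1 hk ha hpm hmq).le
  -- the largest `m` with `m.choose a ≤ #𝒞`
  obtain ⟨m, hpm, hmq, hm1, hm2⟩ : ∃ m, p ≤ m ∧ m < q ∧ m.choose a ≤ #𝒞 ∧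
      #𝒞 < (m + 1).choose a := by
    by_contra! hcon
    have : ∀ m, p ≤ m → m ≤ q → m.choose a ≤ #𝒞 := fun m hm =>
      Nat.le_induction (fun _ => hlo.le)
        (fun m hm ih hmq => hcon m hm (by omega) (ih (by omega))) m hm
    exact absurd (this q hpq le_rfl) (not_le.2 hhi)
  obtain ⟨k, rfl⟩ : ∃ k', k = k' + 1 := ⟨k - 1, by omega⟩
  obtain ⟨a, rfl⟩ : ∃ a', a = a' + 1 := ⟨a - 1, by omega⟩
  obtain ⟨d, t, hd, ht, hda, hdt, hstrict⟩ :=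
    exists_card_eq_choose_add (m := m) h𝒞 (show k < a by omega) (by omega) (by omega) hm1 hm2.le
  have hdlt : d < m.choose a := by
    rw [Nat.choose_succ_succ'] at hm2; omega
  have hA : (0 : ℝ) < m.choose a := by exact_mod_cast Nat.choose_pos (show a ≤ m by omega)
  have hval : c * #𝒞 - #(falling (k + 1) 𝒞) ≤ shadowValue (a + 1) (k + 1) c m + (c * d - t) := by
    have h1 : (#𝒞 : ℝ) = m.choose (a + 1) + d := by exact_mod_cast hd
    have h2 : (m.choose (k + 1) : ℝ) + t ≤ #(falling (k + 1) 𝒞) := by exact_mod_cast ht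
    rw [shadowValue, h1]
    linarith
  have hinc := shadowValue_succ_sub a k c m
  have hm := hmax m hpm hmq.le
  have hm' := hmax (m + 1) (by omega) (by omega)
  rcases Nat.eq_zero_or_pos d with h0 | h0
  · -- the size is that of a Lovász configuration strictly inside the interval
    have hpm' : p < m := by
      refine hpm.lt_of_ne ?_
      rintro rfl
      omega
    have := shadowValue_lt_max c hk1 hk ha hpm' hmq
    subst h0
    have ht0 : (0 : ℝ) ≤ t := t.cast_nonneg
    simp only [Nat.cast_zero, mul_zero, zero_sub] at hval
    linarith
  · have hs : (d : ℝ) * m.choose k < t * m.choose a := by exact_mod_cast hstrict h0 hdlt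
    have hdA : (d : ℝ) ≤ m.choose a := by exact_mod_cast hda
    have hd0 : (0 : ℝ) < d := by exact_mod_cast h0
    -- an upper bound for `c d - t` in terms of the increment `c C(m,a) - C(m,k)`
    have key : (c * d - t) * m.choose a < d * (c * m.choose a - m.choose k) := by nlinarith
    rcases le_or_gt 0 (c * m.choose a - m.choose k : ℝ) with h1 | h1
    · have h2 : (c * d - t) * m.choose a < (c * m.choose a - m.choose k) * m.choose a := by
        nlinarith
      have := lt_of_mul_lt_mul_right h2 hA.le
      linarith
    · have : (c * d - t) * m.choose a < 0 * m.choose a := by nlinarith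
      have := lt_of_mul_lt_mul_right this hA.le
      linarith

/-! ### Cross-intersecting families and shadows of complements -/

theorem mem_kSets {n k : ℕ} {A : Finset (Fin n)} : A ∈ kSets n k ↔ #A = k := by
  simp [kSets]

theorem card_kSets (n k : ℕ) : #(kSets n k) = n.choose k := by
  simp [kSets]

theorem mem_complFamily {n : ℕ} {ℬ : Finset (Finset (Fin n))} {C : Finset (Fin n)} :
    C ∈ complFamily ℬ ↔ Cᶜ ∈ ℬ := by
  simp only [complFamily, mem_image]
  exact ⟨fun ⟨B, hB, h⟩ => by rwa [← h, compl_compl], fun h => ⟨_, h, compl_compl C⟩⟩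

theorem card_complFamily {n : ℕ} (ℬ : Finset (Finset (Fin n))) : #(complFamily ℬ) = #ℬ :=
  card_image_of_injective _ compl_injective

theorem sized_complFamily {n l : ℕ} {ℬ : Finset (Finset (Fin n))} (hℬ : ℬ ⊆ kSets n l) :
    (complFamily ℬ : Set (Finset (Fin n))).Sized (n - l) := by
  intro C hC
  have h := mem_kSets.1 (hℬ (mem_complFamily.1 (mem_coe.1 hC)))
  have h2 := card_add_card_compl C
  rw [Fintype.card_fin] at h2
  omega

/-- A `k`-set meets every member of `ℬ` exactly when it is not in the `k`-shadow of the
complements. -/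
theorem subset_sdiff_falling_complFamily {n k : ℕ} {𝒜 ℬ : Finset (Finset (Fin n))}
    (h𝒜 : 𝒜 ⊆ kSets n k) (hcross : CrossIntersecting 𝒜 ℬ) :
    𝒜 ⊆ kSets n k \ falling k (complFamily ℬ) := by
  intro A hA
  refine mem_sdiff.2 ⟨h𝒜 hA, fun h => ?_⟩
  obtain ⟨⟨C, hC, hAC⟩, -⟩ := mem_falling.1 h
  obtain ⟨x, hx⟩ := hcross A hA _ (mem_complFamily.1 hC)
  rw [mem_inter, mem_compl] at hx
  exact hx.2 (hAC hx.1)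

theorem falling_subset_kSets {n k : ℕ} (𝒞 : Finset (Finset (Fin n))) :
    falling k 𝒞 ⊆ kSets n k := fun _ hT => mem_kSets.2 (mem_falling.1 hT).2

theorem card_kSets_sdiff_falling {n k : ℕ} (𝒞 : Finset (Finset (Fin n))) :
    (#(kSets n k \ falling k 𝒞) : ℝ) = n.choose k - #(falling k 𝒞) := by
  rw [cast_card_sdiff (falling_subset_kSets 𝒞), card_kSets]

theorem kSets_sdiff_powersetCard_compl {n : ℕ} (k : ℕ) (R : Finset (Fin n)) :
    kSets n k \ powersetCard k Rᶜ = meetFamily k R := by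
  ext A
  simp only [mem_sdiff, mem_powersetCard, meetFamily, mem_filter, mem_kSets,
    ← not_disjoint_iff_nonempty_inter, subset_compl_comm (s := A), subset_compl_iff_disjoint_left]
  tauto

theorem complFamily_containFamily {n l : ℕ} (hl : l ≤ n) (R : Finset (Fin n)) :
    complFamily (containFamily l R) = powersetCard (n - l) Rᶜ := by
  ext C
  have h := card_add_card_compl C
  rw [Fintype.card_fin] at h
  rw [mem_complFamily, containFamily, mem_filter, mem_kSets, mem_powersetCard,
    subset_compl_comm, and_comm]
  exact and_congr_right fun _ => by omega

theorem complFamily_injective {n : ℕ} :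
    Function.Injective (complFamily : Finset (Finset (Fin n)) → Finset (Finset (Fin n))) :=
  image_injective compl_injective

theorem card_containFamily {n l : ℕ} (R : Finset (Fin n)) (hR : #R ≤ l) :
    #(containFamily l R) = (n - #R).choose (l - #R) := by
  have := card_filter_powersetCard_subset R univ l (subset_univ _) hR
  rwa [card_univ, Fintype.card_fin] at this

theorem card_meetFamily {n k : ℕ} (R : Finset (Fin n)) :
    (#(meetFamily k R) : ℝ) = n.choose k - (n - #R).choose k := by
  rw [← kSets_sdiff_powersetCard_compl, cast_card_sdiff, card_kSets, card_powersetCard,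
    card_compl, Fintype.card_fin]
  exact fun A hA => mem_kSets.2 (mem_powersetCard.1 hA).2

theorem meetFamily_singleton {n : ℕ} (k : ℕ) (x : Fin n) :
    meetFamily k {x} = (kSets n k).filter (fun A => x ∈ A) := by
  ext A
  simp [meetFamily, ← not_disjoint_iff_nonempty_inter]

theorem containFamily_singleton {n : ℕ} (l : ℕ) (x : Fin n) :
    containFamily l {x} = (kSets n l).filter (fun A => x ∈ A) := by
  ext A
  simp [containFamily]

theorem boundOne_eq_boundR {n k l : ℕ} (c : ℝ) (hk : 1 ≤ k) (hn : 1 ≤ n) :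
    boundOne n k l c = boundR n k l 1 c := by
  obtain ⟨k, rfl⟩ : ∃ k', k = k' + 1 := ⟨k - 1, by omega⟩
  obtain ⟨n, rfl⟩ : ∃ n', n = n' + 1 := ⟨n - 1, by omega⟩
  simp only [boundOne, boundR, Nat.add_sub_cancel, Nat.choose_succ_succ']
  push_cast
  ring

theorem boundR_eq_add_shadowValue {n k l r : ℕ} (c : ℝ) (hrl : r ≤ l) (hl : l ≤ n) :
    boundR n k l r c = n.choose k + shadowValue (n - l) k c (n - r) := by
  rw [boundR, shadowValue, ← Nat.choose_symm_of_eq_add (show n - r = (l - r) + (n - l) by omega)]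
  ring

theorem card_add_mul_card_of_eq {n k l : ℕ} (c : ℝ) {R : Finset (Fin n)} (hR : #R ≤ l) :
    (#(meetFamily k R) : ℝ) + c * #(containFamily l R) = boundR n k l #R c := by
  rw [card_meetFamily, card_containFamily R hR, boundR]

/-- If `ℬ` has the size of a family of all `l`-sets containing a fixed `s`-set, then the weighted
sum is at most that of the corresponding extremal pair, and only that pair attains it. -/
theorem le_boundR_and_eq_of_card_eq {n k l s : ℕ} (c : ℝ) (hk : 1 ≤ k) (hn : k + l < n)
    (hsl : s ≤ l) {𝒜 ℬ : Finset (Finset (Fin n))} (h𝒜 : 𝒜 ⊆ kSets n k) (hℬ : ℬ ⊆ kSets n l)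
    (hcross : CrossIntersecting 𝒜 ℬ) (hcard : #ℬ = (n - s).choose (l - s)) :
    (#𝒜 : ℝ) + c * #ℬ ≤ boundR n k l s c ∧
      ((#𝒜 : ℝ) + c * #ℬ = boundR n k l s c →
        ∃ R : Finset (Fin n), #R = s ∧ 𝒜 = meetFamily k R ∧ ℬ = containFamily l R) := by
  have hsub := subset_sdiff_falling_complFamily h𝒜 hcross
  have hsized := sized_complFamily hℬ
  have hcc : #(complFamily ℬ) = (n - s).choose (n - l) := by
    rw [card_complFamily, hcard,
      Nat.choose_symm_of_eq_add (show n - s = (l - s) + (n - l) by omega)]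
  have h1 : (#𝒜 : ℝ) ≤ n.choose k - #(falling k (complFamily ℬ)) := by
    rw [← card_kSets_sdiff_falling]
    exact_mod_cast card_le_card hsub
  have h2 := choose_le_card_falling (k := k) hsized (by omega) (by omega) (by omega) hcc.ge
  have h2' : ((n - s).choose k : ℝ) ≤ #(falling k (complFamily ℬ)) := by exact_mod_cast h2
  rw [boundR, hcard]
  refine ⟨by linarith, fun heq => ?_⟩
  have hf : #(falling k (complFamily ℬ)) = (n - s).choose k := by
    refine le_antisymm ?_ h2
    have : (#(falling k (complFamily ℬ)) : ℝ) ≤ (n - s).choose k := by linarith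
    exact_mod_cast this
  obtain ⟨S, hS, hSeq⟩ := exists_eq_powersetCard_of_card_falling_eq hsized hk (by omega)
    (by omega) (by omega) hcc hf
  have hA : 𝒜 = kSets n k \ falling k (complFamily ℬ) := by
    refine eq_of_subset_of_card_le hsub ?_
    have : (#(kSets n k \ falling k (complFamily ℬ)) : ℝ) ≤ #𝒜 := by
      rw [card_kSets_sdiff_falling]; linarith
    exact_mod_cast this
  refine ⟨Sᶜ, ?_, ?_, ?_⟩
  · rw [card_compl, Fintype.card_fin, hS]; omega
  · rw [hA, hSeq, falling_powersetCard (by omega) (by omega), ← kSets_sdiff_powersetCard_compl,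
      compl_compl]
  · apply complFamily_injective
    rw [complFamily_containFamily (by omega), compl_compl, hSeq]

/-- When `n = k + l`, cross-intersection only forbids `𝒜` to contain complements of members of
`ℬ`. -/
theorem card_add_mul_card_of_eq_add {n k l : ℕ} (c : ℝ) (hn : n = k + l)
    {𝒜 ℬ : Finset (Finset (Fin n))} (h𝒜 : 𝒜 ⊆ kSets n k) (hℬ : ℬ ⊆ kSets n l)
    (hcross : CrossIntersecting 𝒜 ℬ) :
    (#𝒜 : ℝ) + c * #ℬ ≤ n.choose k + (c - 1) * #ℬ ∧
      ((#𝒜 : ℝ) + c * #ℬ = n.choose k + (c - 1) * #ℬ ↔ 𝒜 = kSets n k \ complFamily ℬ) := by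
  have hsub := subset_sdiff_falling_complFamily h𝒜 hcross
  have hsized := sized_complFamily hℬ
  rw [show n - l = k by omega] at hsized
  have hcard := card_kSets_sdiff_falling (k := k) (complFamily ℬ)
  rw [falling_self hsized] at hsub hcard
  rw [card_complFamily] at hcard
  have h1 : (#𝒜 : ℝ) ≤ #(kSets n k \ complFamily ℬ) := by exact_mod_cast card_le_card hsub
  refine ⟨by linarith, fun h => ?_, fun h => ?_⟩
  · refine eq_of_subset_of_card_le hsub ?_
    have : (#(kSets n k \ complFamily ℬ) : ℝ) ≤ #𝒜 := by linarith
    exact_mod_cast this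
  · rw [h, hcard]; ring

theorem boundR_of_eq_add {n k l r : ℕ} (c : ℝ) (hn : n = k + l) (hrl : r ≤ l) :
    boundR n k l r c = n.choose k + (c - 1) * (n - r).choose (l - r) := by
  rw [boundR, ← Nat.choose_symm_of_eq_add (show n - r = (l - r) + k by omega)]
  ring

/-! ### The weighted bound -/

theorem theorem1p4 (n k l r : ℕ) (hk : 1 ≤ k) (hn : k + l ≤ n) (hrl : r ≤ l) (hr : 1 ≤ r)
    (c : ℝ) (hc : 0 < c) (𝒜 ℬ : Finset (Finset (Fin n)))
    (h𝒜 : 𝒜 ⊆ kSets n k) (hℬ : ℬ ⊆ kSets n l) (hcross : CrossIntersecting 𝒜 ℬ)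
    (hlow : (n - r).choose (l - r) ≤ ℬ.card) (hup : ℬ.card ≤ (n - 1).choose (l - 1)) :
    (𝒜.card : ℝ) + c * (ℬ.card : ℝ) ≤ max (boundR n k l r c) (boundOne n k l c) ∧
    ((𝒜.card : ℝ) + c * (ℬ.card : ℝ) = max (boundR n k l r c) (boundOne n k l c) ↔
      (boundOne n k l c ≤ boundR n k l r c ∧ k + l < n ∧
        ∃ R : Finset (Fin n), R.card = r ∧ 𝒜 = meetFamily k R ∧ ℬ = containFamily l R) ∨
      (boundR n k l r c ≤ boundOne n k l c ∧ k + l < n ∧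
        ∃ x : Fin n, 𝒜 = (kSets n k).filter (fun A => x ∈ A) ∧
          ℬ = (kSets n l).filter (fun B => x ∈ B)) ∨
      (n = k + l ∧ c < 1 ∧ ℬ.card = (n - r).choose (l - r) ∧
        𝒜 = kSets n k \ complFamily ℬ) ∨
      (n = k + l ∧ c = 1 ∧ (n - r).choose (l - r) ≤ ℬ.card ∧
        ℬ.card ≤ (n - 1).choose (l - 1) ∧ 𝒜 = kSets n k \ complFamily ℬ) ∨
      (n = k + l ∧ 1 < c ∧ ℬ.card = (n - 1).choose (l - 1) ∧
        𝒜 = kSets n k \ complFamily ℬ)) := by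
  have hone := boundOne_eq_boundR (l := l) c hk (show 1 ≤ n by omega)
  rcases hn.lt_or_eq with hlt | heq
  · have hne : n ≠ k + l := hlt.ne'
    simp only [hlt, hne, true_and, false_and, or_false]
    have hsize : #ℬ = (n - r).choose (l - r) ∨ #ℬ = (n - 1).choose (l - 1) ∨
        (#𝒜 : ℝ) + c * #ℬ < max (boundR n k l r c) (boundOne n k l c) := by
      by_contra! h
      obtain ⟨h1, h2, h3⟩ := h
      refine absurd h3 (not_le.2 ?_)
      have hA : (#𝒜 : ℝ) ≤ #(kSets n k \ falling k (complFamily ℬ)) := by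
        exact_mod_cast card_le_card (subset_sdiff_falling_complFamily h𝒜 hcross)
      rw [card_kSets_sdiff_falling] at hA
      have hs := sub_card_falling_lt_max c (sized_complFamily hℬ) hk
        (show k < n - l by omega) (show n - l ≤ n - r by omega) (show n - r ≤ n - 1 by omega)
        (Nat.sub_le _ _)
        (by
          rw [card_complFamily, Nat.choose_symm_of_eq_add (show n - r = (n - l) + (l - r) by omega)]
          exact lt_of_le_of_ne hlow h1.symm)
        (by
          rw [card_complFamily, Nat.choose_symm_of_eq_add (show n - 1 = (n - l) + (l - 1) by omega)]
          exact lt_of_le_of_ne hup h2)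
      rw [card_complFamily] at hs
      rw [hone, boundR_eq_add_shadowValue c hrl (by omega),
        boundR_eq_add_shadowValue c (hr.trans hrl) (by omega), max_add_add_left]
      linarith
    refine ⟨?_, fun hmax => ?_, ?_⟩
    · rcases hsize with h | h | h
      · exact (le_boundR_and_eq_of_card_eq c hk hlt hrl h𝒜 hℬ hcross h).1.trans (le_max_left _ _)
      · rw [hone]
        exact (le_boundR_and_eq_of_card_eq c hk hlt (hr.trans hrl) h𝒜 hℬ hcross h).1.trans
          (le_max_right _ _)
      · exact h.le
    · rcases hsize with h | h | h
      · obtain ⟨h1, h2⟩ := le_boundR_and_eq_of_card_eq c hk hlt hrl h𝒜 hℬ hcross h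
        rw [hmax] at h1 h2
        have hle := (le_max_right _ _).trans h1
        exact Or.inl ⟨hle, h2 (max_eq_left hle)⟩
      · obtain ⟨h1, h2⟩ := le_boundR_and_eq_of_card_eq c hk hlt (hr.trans hrl) h𝒜 hℬ hcross h
        rw [hmax, ← hone] at h1 h2
        have hle := (le_max_left _ _).trans h1
        obtain ⟨R, hR, hRA, hRB⟩ := h2 (max_eq_right hle)
        obtain ⟨x, rfl⟩ := card_eq_one.1 hR
        rw [meetFamily_singleton] at hRA
        rw [containFamily_singleton] at hRB
        exact Or.inr ⟨hle, x, hRA, hRB⟩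
      · exact absurd hmax h.ne
    · rintro (⟨hle, R, rfl, rfl, rfl⟩ | ⟨hle, x, rfl, rfl⟩)
      · rw [max_eq_left hle, card_add_mul_card_of_eq c hrl]
      · rw [max_eq_right hle, hone, ← meetFamily_singleton, ← containFamily_singleton,
          card_add_mul_card_of_eq c (by rw [card_singleton]; omega), card_singleton]
  · obtain ⟨h1, h2⟩ := card_add_mul_card_of_eq_add c heq.symm h𝒜 hℬ hcross
    have hnlt : ¬ k + l < n := by omega
    simp only [hnlt, eq_true heq.symm, true_and, false_and, and_false, false_or]
    have hR := boundR_of_eq_add c heq.symm hrl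
    have hO := boundR_of_eq_add c heq.symm (hr.trans hrl)
    rw [← hone] at hO
    have hlow' : ((n - r).choose (l - r) : ℝ) ≤ #ℬ := by exact_mod_cast hlow
    have hup' : (#ℬ : ℝ) ≤ (n - 1).choose (l - 1) := by exact_mod_cast hup
    rcases lt_trichotomy c 1 with hc1 | rfl | hc1
    · -- a negative weight `c - 1` favours the least size of `ℬ`
      have hmax : max (boundR n k l r c) (boundOne n k l c) =
          n.choose k + (c - 1) * (n - r).choose (l - r) := by
        rw [max_eq_left, hR]
        rw [hR, hO]
        nlinarith
      simp only [hmax, hc1, hc1.ne, hc1.not_gt, true_and, false_and, or_false]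
      refine ⟨by nlinarith, fun h => ?_, fun ⟨hb, hA⟩ => ?_⟩
      · have hb : (#ℬ : ℝ) = (n - r).choose (l - r) := by nlinarith
        exact ⟨by exact_mod_cast hb, h2.1 (by rw [h, hb])⟩
      · rw [h2.2 hA, hb]
    · have hmax : max (boundR n k l r 1) (boundOne n k l 1) =
          n.choose k + (1 - 1) * (#ℬ : ℝ) := by
        rw [hR, hO]; simp
      simp only [hmax, lt_irrefl, hlow, hup, true_and, false_and, or_false, false_or]
      exact ⟨h1, h2⟩
    · have hmax : max (boundR n k l r c) (boundOne n k l c) =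
          n.choose k + (c - 1) * (n - 1).choose (l - 1) := by
        rw [max_eq_right, hO]
        rw [hR, hO]
        nlinarith
      simp only [hmax, hc1, hc1.ne', hc1.not_gt, true_and, false_and, false_or]
      refine ⟨by nlinarith, fun h => ?_, fun ⟨hb, hA⟩ => ?_⟩
      · have hb : (#ℬ : ℝ) = (n - 1).choose (l - 1) := by nlinarith
        exact ⟨by exact_mod_cast hb, h2.1 (by rw [h, hb])⟩
      · rw [h2.2 hA, hb]
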